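/- Let $\mathbb{K}$ be an algebraically closed field of arbitrary characteristic, let $(m_1,n_1),\dots,(m_R,n_R)\in\mathbb{Z}^2$, $\alpha,\beta\in\mathbb{K}^\times$ and $v_1,\dots,v_R\in\mathbb{K}$, and set $$f(t):=\alpha\prod_{k=1}^R(t-v_k)^{m_k},\qquad g(t):=\beta\prod_{k=1}^R(t-v_k)^{n_k}\qquad\text{in }\mathbb{K}(t).$$ Let $i\neq j$ be indices such that $(m_i,n_i)$ and $(m_j,n_j)$ are linearly independent, and fix $\alpha$, $\beta$ and all $v_k$ with $k\ne i,j$ arbitrarily. Then, for all $(v_i,v_j)$ in a dense Zariski open subset of $\mathbb{K}^2$, the rational map $$\rho:\mathbb{K}^\times\dashrightarrow(\mathbb{K}^\times)^2,\qquad t\mapsto(f(t),g(t))$$ has degree $1$, that is, its fibre above a generic point of its image consists of exactly one point. Moreover, for these $(v_i,v_j)$, the map $\rho$ is birational onto the Zariski closure of its image, that is, $\mathbb{K}(f,g)=\mathbb{K}(t)$, if $\operatorname{char}\mathbb{K}=0$, or if $\operatorname{char}\mathbb{K}=p>0$ and $f,g$ are not both $p$-th powers in $\mathbb{K}(t)$.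 -/

import Mathlib

/-- The rational function `c * ∏ k, (t - v k) ^ e k` of `K(t)`, with integer exponents. -/
noncomputable def factoredRatFunc {K : Type*} [Field K] {R : ℕ} (c : K) (v : Fin R → K)
    (e : Fin R → ℤ) : RatFunc K :=
  RatFunc.C c * ∏ k, (RatFunc.X - RatFunc.C (v k)) ^ e k

/-- A property of the points `(a, b)` of the affine plane `K²` is generic if it holds on a dense
Zariski open subset. As `K²` is irreducible (`K` infinite), this means that it holds on the
complement of the zero set of some non-zero polynomial in two variables. -/
def GenericPair {K : Type*} [Field K] (P : K → K → Prop) : Prop :=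
  ∃ H : MvPolynomial (Fin 2) K, H ≠ 0 ∧
    ∀ a b : K, MvPolynomial.eval ![a, b] H ≠ 0 → P a b

/-- The domain of definition of the rational map `t ↦ (f(t), g(t))` from the torus `K \ {0}` to
the torus `(K \ {0})²`: the non-zero points which are neither zeros nor poles of `f` and `g`. -/
def torusDomain {K : Type*} [Field K] (f g : RatFunc K) : Set K :=
  {t | t ≠ 0 ∧ f.num.eval t ≠ 0 ∧ f.denom.eval t ≠ 0 ∧ g.num.eval t ≠ 0 ∧ g.denom.eval t ≠ 0}

/-- The value `(f(t), g(t))`; only used at points `t` of `torusDomain f g`. -/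
noncomputable def ratTorusMap {K : Type*} [Field K] (f g : RatFunc K) (t : K) : K × K :=
  (RatFunc.eval (RingHom.id K) t f, RatFunc.eval (RingHom.id K) t g)

/-- The rational map `t ↦ (f(t), g(t))` has degree `d`, in the sense of the cardinality of the
fibre above a generic point of its image: the fibre through `t` has exactly `d` points, for all
but finitely many points `t` of the domain. (Never true if the map is constant, as then all
fibres are infinite.) -/
def HasTorusDegree {K : Type*} [Field K] (f g : RatFunc K) (d : ℕ) : Prop :=
  {t ∈ torusDomain f g |
    {s ∈ torusDomain f g | ratTorusMap f g s = ratTorusMap f g t}.encard ≠ (d : ℕ∞)}.Finite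

/-- The rational map `t ↦ (f(t), g(t))` is birational (onto the Zariski closure `C` of its image):
the function field `K(C)`, identified with the subfield `K(f, g)` by pull-back, is all of
`K(t)`. -/
def IsTorusBirational {K : Type*} [Field K] (f g : RatFunc K) : Prop :=
  IntermediateField.adjoin K ({f, g} : Set (RatFunc K)) = ⊤

/-!
Eliminating one of the two factors `t - a`, `t - b` (where `a = v_i`, `b = v_j`) from `f` and `g`
by linear independence of the exponents, one gets monomials `f ^ p * g ^ q` of the shape
`(t - a) ^ N * φ(t)` and `(t - b) ^ N * ψ(t)`, up to constants, with the same `N > 0` and with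
`φ`, `ψ` independent of `a` and `b`. If `f` and `g` agree at two points `s ≠ t`, then so do these
monomials, which gives one equation between `a`, `s`, `t` and one between `b`, `s`, `t`
(`fiberRel`). For given `s ≠ t`, each has only finitely many solutions `a`, respectively `b`.

The second point `t` is eliminated by a resultant (`exists_C_mem_span_of_eval_roots_ne_zero`). As
both equations have the trivial solution `t = s`, the first one must be divided by the highest
possible power of `t - s` before. The resultant is then a non-zero polynomial `H(a, s, b)`
(`exists_aevalTower_eq_zero`): a root `t` of the reduced first equation is algebraic over
`K(a, s)` and different from `s`, so the second equation is a non-zero polynomial in `b` at this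
`t`. For generic `(a, b)` the polynomial `r(s) = H(a, s, b)` is non-zero, and every point `s` that
`f` and `g` do not separate from some other point, *with coordinates in any extension field
of `K`*, is a root of `r` (`genericPair_separates`).

Over `K` itself this shows that the map has degree one (`hasTorusDegree_one_of_separates`). For
birationality, apply it to the generic point `s = X` of the line, with `t` in an algebraic closure
of `K(X)`: it follows that `X` is the only root of its minimal polynomial over `K(f, g)`. If `f` or
`g` has non-zero derivative, this minimal polynomial is separable, hence linear
(`isTorusBirational_of_separates`). Functions with zero derivative are constant in characteristic
zero, and `p`-th powers in characteristic `p`.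
-/

universe u

/-! ### Eliminating the second point of a fibre -/

/-- The equation `F(t) = F(s)` for `F = (X - a) ^ N * A / B`, with denominators cleared. -/
noncomputable def fiberRel {K S : Type*} [Field K] [CommRing S] [Algebra K S] (N : ℕ)
    (A B : Polynomial K) (a s t : S) : S :=
  (t - a) ^ N * (Polynomial.aeval t A * Polynomial.aeval s B) -
    (s - a) ^ N * (Polynomial.aeval s A * Polynomial.aeval t B)

section

open Polynomial

theorem map_fiberRel {K S S' : Type*} [Field K] [CommRing S] [Algebra K S] [CommRing S']
    [Algebra K S'] (φ : S →ₐ[K] S') (N : ℕ) (A B : K[X]) (a s t : S) :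
    φ (fiberRel N A B a s t) = fiberRel N A B (φ a) (φ s) (φ t) := by
  simp only [fiberRel, map_sub, map_mul, map_pow, Polynomial.aeval_algHom_apply]

/-- If `Q`, whose coefficients involve a further variable, vanishes identically at no root of `P`,
then the ideal `(P, Q)` contains a non-zero constant: their resultant. -/
theorem exists_C_mem_span_of_eval_roots_ne_zero {R : Type*} [CommRing R] [IsDomain R]
    {P : R[X]} (hP : P ≠ 0) (Q : R[X][X])
    (h : ∀ τ : AlgebraicClosure (FractionRing R), aeval τ P = 0 →
      (Q.map (mapRingHom (algebraMap R (AlgebraicClosure (FractionRing R))))).eval (C τ) ≠ 0) :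
    ∃ H : R[X], H ≠ 0 ∧ ∃ U V : R[X][X], P.map C * U + Q * V = C H := by
  set F := AlgebraicClosure (FractionRing R)
  have hinj : Function.Injective (algebraMap R F) := by
    rw [IsScalarTower.algebraMap_eq R (FractionRing R) F]
    exact (algebraMap (FractionRing R) F).injective.comp (IsFractionRing.injective R _)
  have hPC : (P.map (C : R →+* R[X])).natDegree = P.natDegree :=
    natDegree_map_eq_of_injective C_injective P
  -- The resultant of two constants is `1`, which need not lie in the ideal they generate.
  by_cases h0 : P.natDegree = 0
  · refine ⟨C (P.coeff 0), ?_, 1, 0, ?_⟩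
    · rw [eq_C_of_natDegree_eq_zero h0] at hP
      simpa using hP
    · conv_lhs => rw [eq_C_of_natDegree_eq_zero h0]
      simp
  obtain ⟨U, V, -, -, hUV⟩ := exists_mul_add_mul_eq_C_resultant (P.map (C : R →+* R[X])) Q
    (m := P.natDegree) (n := Q.natDegree) hPC.le le_rfl (Or.inl h0)
  refine ⟨_, ?_, U, V, hUV⟩
  set Ψ : R[X] →+* F[X] := mapRingHom (algebraMap R F) with hΨ
  intro hres
  have h1 : resultant ((P.map C).map Ψ) (Q.map Ψ) P.natDegree Q.natDegree = 0 := by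
    rw [resultant_map_map, hres, map_zero]
  have h2 : (P.map C).map Ψ = (P.map (algebraMap R F)).map C := by
    rw [Polynomial.map_map, Polynomial.map_map]
    congr 1
    ext x
    simp [hΨ]
  have hsp : ((P.map (algebraMap R F)).map (C : F →+* F[X])).Splits :=
    (IsAlgClosed.splits (P.map (algebraMap R F))).map C
  have hdeg : ((P.map (algebraMap R F)).map (C : F →+* F[X])).natDegree = P.natDegree := by
    rw [natDegree_map_eq_of_injective C_injective, natDegree_map_eq_of_injective hinj]
  have hroots := (IsAlgClosed.splits (P.map (algebraMap R F))).roots_map (C : F →+* F[X])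
  rw [h2] at h1
  have h3 := resultant_eq_prod_eval ((P.map (algebraMap R F)).map (C : F →+* F[X])) (Q.map Ψ)
    Q.natDegree natDegree_map_le hsp
  rw [hdeg, h1, hroots, eq_comm, mul_eq_zero] at h3
  rcases h3 with h3 | h3
  · have h4 := eq_zero_of_pow_eq_zero h3
    rw [leadingCoeff_eq_zero, Polynomial.map_eq_zero_iff C_injective,
      Polynomial.map_eq_zero_iff hinj] at h4
    exact hP h4
  · rw [Multiset.prod_eq_zero_iff, Multiset.map_map, Multiset.mem_map] at h3
    obtain ⟨τ, hτ, hτ0⟩ := h3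
    refine h τ ?_ hτ0
    have := (mem_roots'.1 hτ).2
    rwa [IsRoot.def, eval_map_algebraMap] at this

/-- Evaluation of a polynomial in three variables at `(a, s, b)`, where `a` belongs to the innermost
and `b` to the outermost variable of `K[X][X][X]`. -/
noncomputable def evalTriple (K : Type*) {S : Type*} [Field K] [CommRing S] [Algebra K S]
    (a s b : S) : K[X][X][X] →ₐ[K] S :=
  aevalTower (aevalTower (aeval a) s) b

theorem map_evalTriple {K S S' : Type*} [Field K] [CommRing S] [Algebra K S] [CommRing S']
    [Algebra K S'] (φ : S →ₐ[K] S') (a s b : S) (H : K[X][X][X]) :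
    φ (evalTriple K a s b H) = evalTriple K (φ a) (φ s) (φ b) H := by
  have h : φ.comp (evalTriple K a s b) = evalTriple K (φ a) (φ s) (φ b) := by
    ext <;> simp [evalTriple]
  rw [← h, AlgHom.comp_apply]

theorem exists_eval_algebraMap_ne_zero {K S : Type*} [Field K] [Infinite K] [CommRing S]
    [IsDomain S] [Algebra K S] {p : S[X]} (hp : p ≠ 0) :
    ∃ x : K, p.eval (algebraMap K S x) ≠ 0 := by
  by_contra! h
  refine hp (eq_zero_of_infinite_isRoot p ?_)
  refine (Set.infinite_range_of_injective (algebraMap K S).injective).mono ?_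
  rintro _ ⟨x, rfl⟩
  exact h x

theorem exists_evalTriple_ne_zero {K : Type*} [Field K] [Infinite K] {H : K[X][X][X]}
    (hH : H ≠ 0) : ∃ a s b : K, evalTriple K a s b H ≠ 0 := by
  obtain ⟨b, hb⟩ := exists_eval_algebraMap_ne_zero (K := K) hH
  obtain ⟨s, hs⟩ := exists_eval_algebraMap_ne_zero (K := K) hb
  obtain ⟨a, ha⟩ := exists_eval_algebraMap_ne_zero (K := K) hs
  refine ⟨a, s, b, ?_⟩
  have key : evalTriple K a s b =
      ((aeval a).comp ((aeval (algebraMap K K[X] s)).restrictScalars K)).comp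
        ((aeval (algebraMap K K[X][X] b)).restrictScalars K) := by
    ext <;> simp [evalTriple]
  rw [key]
  simpa [aeval_def, eval₂_eq_eval_map] using ha

/-- The outer variable of `K[X][X]` is transcendental over the constants `K`. -/
theorem transcendental_X_X (K : Type*) [Field K] : Transcendental K (X : K[X][X]) := by
  rintro ⟨p, hp, h⟩
  refine hp ((map_eq_zero_iff C C_injective).1 ?_)
  have : aeval (X : K[X][X]) p = p.map C := by
    rw [← aeval_map_algebraMap K[X], aeval_X_left_apply, algebraMap_eq]
  rwa [this, Polynomial.map_eq_zero_iff C_injective, ← C_eq_zero] at h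

theorem fiberRel_C_C_X_ne_zero {K D : Type*} [Field K] [CommRing D] [IsDomain D] [Algebra K D]
    {N : ℕ} {A B : K[X]} (hA : A ≠ 0) (hB : B ≠ 0) (hN : N ≠ 0) {a σ : D} (ha : Transcendental K a)
    (hσ : Transcendental K σ) (haσ : σ ≠ a) :
    fiberRel N A B (C a) (C σ) (X : D[X]) ≠ 0 := by
  intro h
  -- At `t = a` the first term vanishes, while the second one is a non-zero product.
  have h1 := congrArg (aevalTower (AlgHom.id K D) a) h
  rw [map_fiberRel, aevalTower_C, aevalTower_C, aevalTower_X, map_zero] at h1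
  simp only [fiberRel, AlgHom.id_apply, sub_self, zero_pow hN, zero_mul, zero_sub,
    neg_eq_zero] at h1
  exact mul_ne_zero (pow_ne_zero N (sub_ne_zero.2 haσ))
    (mul_ne_zero (fun h ↦ hσ ⟨A, hA, h⟩) fun h ↦ ha ⟨B, hB, h⟩) h1

/-- For `t ≠ s`, the equation `fiberRel N A B b s t = 0` is not an identity in `b`: putting `b = s`
and `b = t` would show that `A` and `B` both vanish at `t`. -/
theorem fiberRel_X_ne_zero {K L : Type*} [Field K] [Field L] [Algebra K L] {N : ℕ} {A B : K[X]}
    (hAB : IsCoprime A B) (hA : A ≠ 0) (hB : B ≠ 0) (hN : N ≠ 0) {s t : L} (hst : s ≠ t)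
    (hs : Transcendental K s) :
    fiberRel N A B (X : L[X]) (C s) (C t) ≠ 0 := by
  intro h
  have h1 := congrArg (aevalTower (AlgHom.id K L) s) h
  have h2 := congrArg (aevalTower (AlgHom.id K L) t) h
  rw [map_fiberRel, aevalTower_X, aevalTower_C, aevalTower_C, map_zero] at h1 h2
  simp only [fiberRel, AlgHom.id_apply, sub_self, zero_pow hN, zero_mul, zero_sub, sub_zero,
    neg_eq_zero, mul_eq_zero, pow_eq_zero_iff hN, sub_eq_zero, hst, hst.symm, false_or] at h1 h2
  have hA' : aeval s A ≠ 0 := fun h ↦ hs ⟨A, hA, h⟩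
  have hB' : aeval s B ≠ 0 := fun h ↦ hs ⟨B, hB, h⟩
  obtain ⟨u, v, huv⟩ := hAB
  have h3 := congrArg (aeval t) huv
  simp [h1.resolve_right hB', h2.resolve_left hA'] at h3

/-- For distinct `a`, `σ` in a domain `D`, both transcendental over `K` (such as the variables of
`D = K[a, σ]`), there is a non-zero polynomial `H` over `D` which `b` must satisfy if
`(X - a) ^ N * A / B` and `(X - b) ^ N * A' / B'` both fail to separate `σ` from one and the same
other point `t`. This persists under specialization `φ` of `a` and `σ`. The second equation is not
an identity in `b` because `A'` and `B'` are coprime. -/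
theorem exists_aevalTower_eq_zero {K D : Type*} [Field K] [CommRing D] [IsDomain D] [Algebra K D]
    {N : ℕ} (hN : N ≠ 0) {A B A' B' : K[X]} (hA : A ≠ 0) (hB : B ≠ 0) (hA' : A' ≠ 0) (hB' : B' ≠ 0)
    (hAB' : IsCoprime A' B') {a σ : D} (ha : Transcendental K a) (hσ : Transcendental K σ)
    (haσ : σ ≠ a) :
    ∃ H : D[X], H ≠ 0 ∧ ∀ (S : Type*) [Field S] [Algebra K S] (φ : D →ₐ[K] S) (b t : S),
      φ σ ≠ t → fiberRel N A B (φ a) (φ σ) t = 0 → fiberRel N A' B' b (φ σ) t = 0 →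
        aevalTower φ b H = 0 := by
  -- The factor `X - σ` of the first equation has to be removed, to its full multiplicity:
  -- in positive characteristic this may exceed one.
  obtain ⟨P, hP, hPX⟩ := exists_eq_pow_rootMultiplicity_mul_and_not_dvd _
    (fiberRel_C_C_X_ne_zero hA hB hN ha hσ haσ) σ
  set M := rootMultiplicity σ (fiberRel N A B (C a) (C σ) X)
  have hP0 : P ≠ 0 := by
    rintro rfl
    exact hPX (dvd_zero _)
  obtain ⟨H, hH, U, V, hUV⟩ := exists_C_mem_span_of_eval_roots_ne_zero hP0
    (fiberRel N A' B' (C X : D[X][X]) (C (C σ)) X) (by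
      set F := AlgebraicClosure (FractionRing D)
      intro τ hτ
      have hinj : Function.Injective (algebraMap D F) := by
        rw [IsScalarTower.algebraMap_eq D (FractionRing D) F]
        exact (algebraMap (FractionRing D) F).injective.comp (IsFractionRing.injective _ _)
      have hστ : algebraMap D F σ ≠ τ := by
        intro h
        rw [← h, aeval_algebraMap_apply, map_eq_zero_iff _ hinj, coe_aeval_eq_eval] at hτ
        exact hPX (dvd_iff_isRoot.2 hτ)
      let ψ : D[X][X] →ₐ[K] F[X] := aevalTower (mapAlgHom (IsScalarTower.toAlgHom K D F)) (C τ)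
      have h2 : ∀ Q : D[X][X], (Q.map (mapRingHom (algebraMap D F))).eval (C τ) = ψ Q := by
        intro Q
        rw [eval_map]
        rfl
      rw [h2, map_fiberRel]
      convert fiberRel_X_ne_zero hAB' hA' hB' hN hστ
        ((transcendental_algebraMap_iff hinj).2 hσ) using 2 <;> simp [ψ])
  refine ⟨H, hH, fun S _ _ φ b t hst h1 h2 ↦ ?_⟩
  have h3 := congrArg (aevalTower φ t) hP
  rw [map_fiberRel, map_mul, map_pow, map_sub, aevalTower_C, aevalTower_C, aevalTower_X, h1,
    eq_comm, mul_eq_zero] at h3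
  have h4 : aevalTower φ t P = 0 := h3.resolve_left (pow_ne_zero _ (sub_ne_zero.2 hst.symm))
  let ψ : D[X][X] →ₐ[K] S := aevalTower (aevalTower φ b) t
  have h5 : ψ (P.map C) = aevalTower φ t P := by
    have h : ψ.comp (mapAlgHom (CAlgHom (R := K))) = aevalTower φ t := by
      ext <;> simp [ψ]
    rw [← h]
    rfl
  have h6 := congrArg ψ hUV
  rw [map_add, map_mul, map_mul, map_fiberRel, h5, h4] at h6
  simpa [ψ, h2] using h6.symm

/-- For generic `(a, b)`, the functions `(X - a) ^ N * A / B` and `(X - b) ^ N * A' / B'` separate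
a point `s` from all others, in any extension field, unless `s` is a root of a certain
polynomial. -/
theorem genericPair_fiberRel {K : Type u} [Field K] [Infinite K] {N : ℕ} (hN : N ≠ 0)
    {A B A' B' : K[X]} (hA : A ≠ 0) (hB : B ≠ 0) (hA' : A' ≠ 0) (hB' : B' ≠ 0)
    (hAB' : IsCoprime A' B') :
    GenericPair fun a b : K ↦ ∃ r : K[X], r ≠ 0 ∧ ∀ (L : Type u) [Field L] [Algebra K L] (s t : L),
      s ≠ t → fiberRel N A B (algebraMap K L a) s t = 0 →
        fiberRel N A' B' (algebraMap K L b) s t = 0 → aeval s r = 0 := by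
  obtain ⟨H, hH, hrel⟩ := exists_aevalTower_eq_zero hN hA hB hA' hB' hAB'
    (a := (C X : K[X][X])) (σ := X)
    ((transcendental_algebraMap_iff C_injective).2 (transcendental_X K)) (transcendental_X_X K)
    (X_ne_C _)
  obtain ⟨a₀, s₀, b₀, h₀⟩ := exists_evalTriple_ne_zero hH
  have hev : ∀ a b : K, MvPolynomial.eval ![a, b]
      (evalTriple K (MvPolynomial.X 0) (MvPolynomial.C s₀) (MvPolynomial.X (1 : Fin 2)) H) =
        evalTriple K a s₀ b H := by
    intro a b
    rw [← MvPolynomial.coe_aeval_eq_eval, RingHom.coe_coe, map_evalTriple]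
    simp
  refine ⟨evalTriple K (MvPolynomial.X 0) (MvPolynomial.C s₀) (MvPolynomial.X 1) H, ?_, ?_⟩
  · intro h
    apply h₀
    rw [← hev, h, map_zero]
  · intro a b hab
    rw [hev] at hab
    refine ⟨evalTriple K (C a) X (C b) H, ?_, fun L _ _ s t hst h1 h2 ↦ ?_⟩
    · intro h
      apply hab
      have := congrArg (aeval s₀) h
      rw [map_evalTriple] at this
      simpa using this
    · rw [map_evalTriple, aeval_C, aeval_C, aeval_X]
      refine hrel L (aevalTower (aeval (algebraMap K L a)) s) _ t ?_ ?_ ?_ <;>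
        simpa using by assumption

/-! ### Values of rational functions in an extension field -/

/-- The point `t` of an extension field of `K` is neither a zero nor a pole of `r`. -/
def RatFunc.IsUnitAt {K L : Type*} [Field K] [Field L] [Algebra K L] (t : L) (r : RatFunc K) :
    Prop :=
  aeval t r.num ≠ 0 ∧ aeval t r.denom ≠ 0

namespace RatFunc

variable {K L : Type u} [Field K] [Field L] [Algebra K L] {t : L} {x y : RatFunc K}

theorem eval_eq_aeval_div (t : L) (x : RatFunc K) :
    eval (algebraMap K L) t x = aeval t x.num / aeval t x.denom := rfl

theorem IsUnitAt.mul (hx : IsUnitAt t x) (hy : IsUnitAt t y) : IsUnitAt t (x * y) := by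
  constructor
  · refine ne_zero_of_dvd_ne_zero ?_ (map_dvd (aeval t) (num_mul_dvd x y))
    rw [map_mul]
    exact mul_ne_zero hx.1 hy.1
  · refine ne_zero_of_dvd_ne_zero ?_ (map_dvd (aeval t) (denom_mul_dvd x y))
    rw [map_mul]
    exact mul_ne_zero hx.2 hy.2

theorem IsUnitAt.ne_zero (hx : IsUnitAt t x) : x ≠ 0 := by
  rintro rfl
  exact hx.1 (by simp)

theorem isUnitAt_one (t : L) : IsUnitAt t (1 : RatFunc K) := by
  simp [IsUnitAt]

theorem IsUnitAt.inv (hx : IsUnitAt t x) : IsUnitAt t x⁻¹ :=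
  ⟨ne_zero_of_dvd_ne_zero hx.2 (map_dvd (aeval t) (num_inv_dvd hx.ne_zero)),
    ne_zero_of_dvd_ne_zero hx.1 (map_dvd (aeval t) (denom_inv_dvd hx.ne_zero))⟩

theorem IsUnitAt.eval_mul (hx : IsUnitAt t x) (hy : IsUnitAt t y) :
    eval (algebraMap K L) t (x * y) = eval (algebraMap K L) t x * eval (algebraMap K L) t y :=
  RatFunc.eval_mul _ _ hx.2 hy.2

theorem IsUnitAt.eval_inv (hx : IsUnitAt t x) :
    eval (algebraMap K L) t x⁻¹ = (eval (algebraMap K L) t x)⁻¹ := by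
  apply eq_inv_of_mul_eq_one_left
  rw [← hx.inv.eval_mul hx, inv_mul_cancel₀ hx.ne_zero, eval_one]

theorem IsUnitAt.pow (hx : IsUnitAt t x) (k : ℕ) : IsUnitAt t (x ^ k) ∧
    eval (algebraMap K L) t (x ^ k) = eval (algebraMap K L) t x ^ k := by
  induction k with
  | zero => simpa using isUnitAt_one t
  | succ k ih => exact ⟨by simpa [pow_succ] using ih.1.mul hx, by
      rw [pow_succ, ih.1.eval_mul hx, ih.2, pow_succ]⟩

theorem IsUnitAt.zpow (hx : IsUnitAt t x) (k : ℤ) : IsUnitAt t (x ^ k) ∧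
    eval (algebraMap K L) t (x ^ k) = eval (algebraMap K L) t x ^ k := by
  obtain ⟨k, rfl | rfl⟩ := k.eq_nat_or_neg
  · simpa using hx.pow k
  · simp only [zpow_neg, zpow_natCast]
    exact ⟨(hx.pow k).1.inv, by rw [(hx.pow k).1.eval_inv, (hx.pow k).2]⟩

/-- If `f` and `g` do not separate `s` and `t`, then neither does a monomial `f ^ p * g ^ q`. With
`φ` in lowest terms, this holds also at points where factors of `f` or `g` have cancelled. -/
theorem fiberRel_eq_zero_of_eval_eq {f g φ : RatFunc K} {p q : ℤ} {γ a : K} {N : ℕ} (hγ : γ ≠ 0)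
    (h : f ^ p * g ^ q = C γ * (X - C a) ^ N * φ) {s t : L} (hfs : IsUnitAt s f)
    (hgs : IsUnitAt s g) (hft : IsUnitAt t f) (hgt : IsUnitAt t g)
    (hf : eval (algebraMap K L) s f = eval (algebraMap K L) t f)
    (hg : eval (algebraMap K L) s g = eval (algebraMap K L) t g) :
    fiberRel N φ.num φ.denom (algebraMap K L a) s t = 0 := by
  set r := f ^ p * g ^ q with hr
  have hpoly : r.num * φ.denom =
      Polynomial.C γ * (Polynomial.X - Polynomial.C a) ^ N * φ.num * r.denom := by
    apply algebraMap_injective K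
    have h1 : (algebraMap K[X] (RatFunc K)) r.denom ≠ 0 := algebraMap_ne_zero r.denom_ne_zero
    have h2 : (algebraMap K[X] (RatFunc K)) φ.denom ≠ 0 := algebraMap_ne_zero φ.denom_ne_zero
    rw [← num_div_denom r, ← num_div_denom φ, ← mul_div_assoc, div_eq_div_iff h1 h2] at h
    simpa using h
  have key : ∀ x : L, IsUnitAt x f → IsUnitAt x g → eval (algebraMap K L) x r * aeval x φ.denom =
      algebraMap K L γ * (x - algebraMap K L a) ^ N * aeval x φ.num := by
    intro x hxf hxg
    have hxr : IsUnitAt x r := (hxf.zpow p).1.mul (hxg.zpow q).1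
    have h3 := congrArg (aeval x) hpoly
    simp only [map_mul, map_pow, map_sub, aeval_C, aeval_X] at h3
    rw [eval_eq_aeval_div, div_mul_eq_mul_div, div_eq_iff hxr.2, h3]
  have hval : ∀ x : L, IsUnitAt x f → IsUnitAt x g → eval (algebraMap K L) x r =
      eval (algebraMap K L) x f ^ p * eval (algebraMap K L) x g ^ q := by
    intro x hxf hxg
    rw [hr, (hxf.zpow p).1.eval_mul (hxg.zpow q).1, (hxf.zpow p).2, (hxg.zpow q).2]
  have hst : eval (algebraMap K L) s r = eval (algebraMap K L) t r := by
    rw [hval s hfs hgs, hval t hft hgt, hf, hg]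
  have hs := key s hfs hgs
  have ht := key t hft hgt
  rw [← hst] at ht
  have hγ' : algebraMap K L γ ≠ 0 := by simpa using hγ
  apply mul_left_cancel₀ hγ'
  rw [fiberRel]
  linear_combination aeval t φ.denom * hs - aeval s φ.denom * ht

end RatFunc

/-! ### Products of powers of linear factors -/

theorem factoredRatFunc_ne_zero {K : Type*} [Field K] {R : ℕ} {c : K} (hc : c ≠ 0)
    (v : Fin R → K) (e : Fin R → ℤ) : factoredRatFunc c v e ≠ 0 := by
  refine mul_ne_zero (by simpa using hc) (Finset.prod_ne_zero_iff.2 fun k _ ↦ zpow_ne_zero _ ?_)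
  rw [← RatFunc.algebraMap_X, ← RatFunc.algebraMap_C, ← map_sub]
  exact RatFunc.algebraMap_ne_zero (X_sub_C_ne_zero _)

theorem factoredRatFunc_zpow_mul_zpow {K : Type*} [Field K] {R : ℕ} (α β : K) (v : Fin R → K)
    (m n : Fin R → ℤ) (p q : ℤ) :
    factoredRatFunc α v m ^ p * factoredRatFunc β v n ^ q =
      factoredRatFunc (α ^ p * β ^ q) v fun k ↦ p * m k + q * n k := by
  have hX : ∀ k, (RatFunc.X - RatFunc.C (v k) : RatFunc K) ≠ 0 := fun k ↦ by
    rw [← RatFunc.algebraMap_X, ← RatFunc.algebraMap_C, ← map_sub]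
    exact RatFunc.algebraMap_ne_zero (X_sub_C_ne_zero _)
  simp only [factoredRatFunc, mul_zpow, map_mul, map_zpow₀, ← Finset.prod_zpow, ← zpow_mul]
  rw [mul_mul_mul_comm, ← Finset.prod_mul_distrib]
  congr 1
  refine Finset.prod_congr rfl fun k _ ↦ ?_
  rw [zpow_add₀ (hX k), mul_comm p, mul_comm q]

/-- If the exponent at `j` vanishes, then the root at `j` does not matter. -/
theorem factoredRatFunc_update {K : Type*} [Field K] {R : ℕ} (c : K) (w v : Fin R → K)
    (e : Fin R → ℤ) {i j : Fin R} (hw : ∀ k, k ≠ i → k ≠ j → w k = v k) {N : ℕ} (hi : e i = N)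
    (hj : e j = 0) :
    factoredRatFunc c w e = RatFunc.C c * (RatFunc.X - RatFunc.C (w i)) ^ N *
      factoredRatFunc 1 v (Function.update e i 0) := by
  simp only [factoredRatFunc, map_one, one_mul, mul_assoc]
  congr 1
  rw [← Finset.mul_prod_erase _ _ (Finset.mem_univ i),
    ← Finset.mul_prod_erase _ (fun k ↦ _ ^ Function.update e i 0 k) (Finset.mem_univ i)]
  simp only [hi, zpow_natCast, Function.update_self, zpow_zero, one_mul]
  congr 1
  refine Finset.prod_congr rfl fun k hk ↦ ?_
  have hki := Finset.ne_of_mem_erase hk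
  rw [Function.update_of_ne hki]
  by_cases hkj : k = j
  · rw [hkj, hj, zpow_zero, zpow_zero]
  · rw [hw k hki hkj]

/-- Generically, `f` and `g` separate points, in every extension field of `K`: only finitely many
points, the roots of `r`, may have a partner with the same values of `f` and `g`. -/
theorem genericPair_separates {K : Type u} [Field K] [Infinite K] (R : ℕ) (m n : Fin R → ℤ)
    (α β : K) (hα : α ≠ 0) (hβ : β ≠ 0) (v : Fin R → K) (i j : Fin R) (hij : i ≠ j)
    (hdet : m i * n j - m j * n i ≠ 0) :
    GenericPair fun a b : K ↦
      let w : Fin R → K := Function.update (Function.update v i a) j b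
      let f : RatFunc K := factoredRatFunc α w m
      let g : RatFunc K := factoredRatFunc β w n
      ∃ r : K[X], r ≠ 0 ∧ ∀ (L : Type u) [Field L] [Algebra K L] (s t : L),
        RatFunc.IsUnitAt s f → RatFunc.IsUnitAt s g → RatFunc.IsUnitAt t f →
        RatFunc.IsUnitAt t g →
        RatFunc.eval (algebraMap K L) s f = RatFunc.eval (algebraMap K L) t f →
        RatFunc.eval (algebraMap K L) s g = RatFunc.eval (algebraMap K L) t g →
        s ≠ t → aeval s r = 0 := by
  set D := m i * n j - m j * n i with hD
  have hN : D.natAbs ≠ 0 := Int.natAbs_ne_zero.2 hdet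
  have hsign : D.sign * D = D.natAbs := Int.sign_mul_self_eq_natAbs D
  -- Up to sign, the exponents `(n j, -m j)` and `(-n i, m i)` eliminate the factors `j` and `i`.
  set e₁ : Fin R → ℤ := fun k ↦ D.sign * n j * m k + -(D.sign * m j) * n k with he₁
  set e₂ : Fin R → ℤ := fun k ↦ -(D.sign * n i) * m k + D.sign * m i * n k with he₂
  set φ₁ : RatFunc K := factoredRatFunc 1 v (Function.update e₁ i 0)
  set φ₂ : RatFunc K := factoredRatFunc 1 v (Function.update e₂ j 0)
  have hφ₁ : φ₁ ≠ 0 := factoredRatFunc_ne_zero one_ne_zero _ _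
  have hφ₂ : φ₂ ≠ 0 := factoredRatFunc_ne_zero one_ne_zero _ _
  obtain ⟨H, hH, hgen⟩ := genericPair_fiberRel hN (RatFunc.num_ne_zero hφ₁) φ₁.denom_ne_zero
    (RatFunc.num_ne_zero hφ₂) φ₂.denom_ne_zero φ₂.isCoprime_num_denom
  refine ⟨H, hH, fun a b hab ↦ ?_⟩
  obtain ⟨r, hr, hrel⟩ := hgen a b hab
  intro w f g
  have hwi : w i = a := by simp [w, hij]
  have hwj : w j = b := by simp [w]
  have hw : ∀ k, k ≠ i → k ≠ j → w k = v k := fun k hi hj ↦ by simp [w, hi, hj]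
  refine ⟨r, hr, fun L _ _ s t hfs hgs hft hgt hf hg hst ↦ hrel L s t hst ?_ ?_⟩
  · refine RatFunc.fiberRel_eq_zero_of_eval_eq (p := D.sign * n j) (q := -(D.sign * m j))
      (mul_ne_zero (zpow_ne_zero (D.sign * n j) hα) (zpow_ne_zero (-(D.sign * m j)) hβ)) ?_
      hfs hgs hft hgt hf hg
    rw [factoredRatFunc_zpow_mul_zpow, factoredRatFunc_update (i := i) (j := j) _ w v e₁ hw, hwi]
    · rw [← hsign, he₁, hD]
      ring
    · rw [he₁]
      ring
  · refine RatFunc.fiberRel_eq_zero_of_eval_eq (p := -(D.sign * n i)) (q := D.sign * m i)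
      (mul_ne_zero (zpow_ne_zero (-(D.sign * n i)) hα) (zpow_ne_zero (D.sign * m i) hβ)) ?_
      hfs hgs hft hgt hf hg
    rw [factoredRatFunc_zpow_mul_zpow,
      factoredRatFunc_update (i := j) (j := i) _ w v e₂ (fun k hj hi ↦ hw k hi hj), hwj]
    · rw [← hsign, he₂, hD]
      ring
    · rw [he₂]
      ring

/-! ### The degree -/

theorem hasTorusDegree_one_of_separates {K : Type*} [Field K] {f g : RatFunc K} {r : K[X]}
    (hr : r ≠ 0)
    (h : ∀ s t : K, RatFunc.IsUnitAt s f → RatFunc.IsUnitAt s g → RatFunc.IsUnitAt t f →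
      RatFunc.IsUnitAt t g →
      RatFunc.eval (algebraMap K K) s f = RatFunc.eval (algebraMap K K) t f →
      RatFunc.eval (algebraMap K K) s g = RatFunc.eval (algebraMap K K) t g →
      s ≠ t → aeval s r = 0) :
    HasTorusDegree f g 1 := by
  refine (rootSet_finite r K).subset ?_
  rintro t ⟨ht, hcard⟩
  by_contra hroot
  rw [mem_rootSet] at hroot
  refine hcard ?_
  rw [Nat.cast_one, Set.encard_eq_one]
  refine ⟨t, Set.eq_singleton_iff_unique_mem.2 ⟨⟨ht, rfl⟩, ?_⟩⟩
  rintro s ⟨hs, hst⟩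
  rw [ratTorusMap, ratTorusMap, Prod.mk.injEq] at hst
  by_contra hne
  refine hroot ⟨hr, h t s ⟨ht.2.1, ht.2.2.1⟩ ht.2.2.2 ⟨hs.2.1, hs.2.2.1⟩ hs.2.2.2 hst.1.symm
    hst.2.symm (Ne.symm hne)⟩

/-! ### Birationality -/

/-- A rational function whose derivative vanishes has numerator and denominator with vanishing
derivative. -/
theorem RatFunc.derivative_num_denom_eq_zero {K : Type*} [Field K] {x : RatFunc K}
    (h : derivative x.num * x.denom - x.num * derivative x.denom = 0) :
    derivative x.num = 0 ∧ derivative x.denom = 0 := by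
  have hdvd : x.denom ∣ derivative x.denom := by
    refine x.isCoprime_num_denom.symm.dvd_of_dvd_mul_left ?_
    rw [← sub_eq_zero.1 h]
    exact dvd_mul_left _ _
  have h0 : derivative x.denom = 0 := by
    by_contra hne
    have hdeg : x.denom.natDegree ≠ 0 := fun h0 ↦ hne (by
      rw [eq_C_of_natDegree_eq_zero h0, derivative_C])
    exact (natDegree_le_of_dvd hdvd hne).not_gt (natDegree_derivative_lt hdeg)
  rw [h0, mul_zero, sub_zero] at h
  exact ⟨(mul_eq_zero.1 h).resolve_right x.denom_ne_zero, h0⟩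

theorem RatFunc.exists_eq_pow_of_derivative_eq_zero {K : Type*} [Field K] [IsAlgClosed K] (p : ℕ)
    [Fact p.Prime] [CharP K p] {x : RatFunc K} (h₁ : derivative x.num = 0)
    (h₂ : derivative x.denom = 0) : ∃ y : RatFunc K, x = y ^ p := by
  have hp : p ≠ 0 := (Fact.out : p.Prime).ne_zero
  have key : ∀ q : K[X], derivative q = 0 → ∃ q' : K[X], q = q' ^ p := by
    intro q hq
    rw [← expand_contract p hq hp, polynomial_expand_eq]
    exact ⟨_, rfl⟩
  obtain ⟨y, hy⟩ := key _ h₁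
  obtain ⟨z, hz⟩ := key _ h₂
  refine ⟨algebraMap _ _ y / algebraMap _ _ z, ?_⟩
  rw [div_pow, ← map_pow, ← map_pow, ← hy, ← hz, num_div_denom]

theorem RatFunc.exists_eq_C_of_derivative_eq_zero {K : Type*} [Field K] [CharZero K]
    {x : RatFunc K} (h₁ : derivative x.num = 0) (h₂ : derivative x.denom = 0) :
    ∃ c, x = C c :=
  (eq_C_iff x).2 ⟨derivative_eq_zero.1 h₁,
    derivative_eq_zero.1 h₂⟩

/-- For `x = P(X) / Q(X)` in a subfield `E` of `K(X)`, the polynomial `P(Y) - x * Q(Y)` in `E[Y]`.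
It has the root `Y = X`, which is simple if the derivative `x'` is not zero, since
`P'(X) - x * Q'(X) = x' * Q(X)`. -/
noncomputable def RatFunc.fiberPoly {K : Type*} [Field K] (E : IntermediateField K (RatFunc K))
    (x : E) : E[X] :=
  (x : RatFunc K).num.map (algebraMap K E) -
    Polynomial.C x * (x : RatFunc K).denom.map (algebraMap K E)

theorem RatFunc.aeval_fiberPoly {K L : Type*} [Field K] {E : IntermediateField K (RatFunc K)}
    [Field L] [Algebra K L] [Algebra E L] [IsScalarTower K E L] (x : E) (t : L) :
    aeval t (fiberPoly E x) = aeval t (x : RatFunc K).num -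
      algebraMap E L x * aeval t (x : RatFunc K).denom := by
  simp [fiberPoly]

theorem RatFunc.aeval_X_fiberPoly {K : Type*} [Field K] {E : IntermediateField K (RatFunc K)}
    (x : E) : aeval (X : RatFunc K) (fiberPoly E x) = 0 := by
  rw [aeval_fiberPoly, aeval_X_left_eq_algebraMap, aeval_X_left_eq_algebraMap, sub_eq_zero,
    IntermediateField.algebraMap_apply, ← div_eq_iff (algebraMap_ne_zero (denom_ne_zero _)),
    num_div_denom]

theorem RatFunc.aeval_X_derivative_fiberPoly_ne_zero {K : Type*} [Field K]
    {E : IntermediateField K (RatFunc K)} {x : E}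
    (h : derivative (x : RatFunc K).num * (x : RatFunc K).denom -
      (x : RatFunc K).num * derivative (x : RatFunc K).denom ≠ 0) :
    aeval (X : RatFunc K) (derivative (fiberPoly E x)) ≠ 0 := by
  intro h0
  apply h
  apply algebraMap_injective K
  have hd : algebraMap K[X] (RatFunc K) (x : RatFunc K).denom ≠ 0 :=
    algebraMap_ne_zero (denom_ne_zero _)
  have hx : algebraMap K[X] (RatFunc K) (x : RatFunc K).num =
      (x : RatFunc K) * algebraMap K[X] (RatFunc K) (x : RatFunc K).denom := by
    rw [← div_eq_iff hd, num_div_denom]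
  simp only [fiberPoly, derivative_mul, derivative_C, derivative_map, zero_mul,
    zero_add, map_sub, map_mul, aeval_map_algebraMap, aeval_C, aeval_X_left_eq_algebraMap,
    IntermediateField.algebraMap_apply] at h0
  rw [map_sub, map_mul, map_mul, hx, map_zero]
  linear_combination algebraMap K[X] (RatFunc K) (x : RatFunc K).denom * h0

/-- If `f` and `g` separate the generic point `X` of the line from all other points, and one of
them has non-zero derivative, then they generate `K(X)`: the minimal polynomial of `X` over
`K(f, g)` is separable, and `X` is its only root. -/
theorem isTorusBirational_of_separates {K : Type u} [Field K] {f g : RatFunc K} (hf0 : f ≠ 0)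
    (hg0 : g ≠ 0) {r : K[X]} (hr : r ≠ 0)
    (h : ∀ (L : Type u) [Field L] [Algebra K L] (s t : L),
      RatFunc.IsUnitAt s f → RatFunc.IsUnitAt s g → RatFunc.IsUnitAt t f →
      RatFunc.IsUnitAt t g →
      RatFunc.eval (algebraMap K L) s f = RatFunc.eval (algebraMap K L) t f →
      RatFunc.eval (algebraMap K L) s g = RatFunc.eval (algebraMap K L) t g →
      s ≠ t → aeval s r = 0)
    (hder : ∃ x ∈ ({f, g} : Set (RatFunc K)),
      derivative x.num * x.denom - x.num * derivative x.denom ≠ 0) :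
    IsTorusBirational f g := by
  set E := IntermediateField.adjoin K ({f, g} : Set (RatFunc K)) with hE
  have hmem : ∀ x ∈ ({f, g} : Set (RatFunc K)), x ∈ E := fun x hx ↦
    IntermediateField.subset_adjoin K _ hx
  have hne0 : ∀ x ∈ ({f, g} : Set (RatFunc K)), x ≠ 0 := by
    rintro x (rfl | rfl) <;> assumption
  obtain ⟨x, hx, hxder⟩ := hder
  have hder' := RatFunc.aeval_X_derivative_fiberPoly_ne_zero (x := (⟨x, hmem x hx⟩ : E)) hxder
  have hint : IsIntegral E (RatFunc.X : RatFunc K) := by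
    refine IsAlgebraic.isIntegral ⟨_, ?_, RatFunc.aeval_X_fiberPoly (⟨x, hmem x hx⟩ : E)⟩
    intro h0
    simp [h0] at hder'
  set μ := minpoly E (RatFunc.X : RatFunc K)
  have hdvd : ∀ y : E, μ ∣ RatFunc.fiberPoly E y := fun y ↦
    minpoly.dvd _ _ (RatFunc.aeval_X_fiberPoly y)
  have hsep : μ.Separable := by
    rw [separable_iff_derivative_ne_zero (minpoly.irreducible hint)]
    intro h0
    obtain ⟨q, hq⟩ := hdvd ⟨x, hmem x hx⟩
    rw [hq, derivative_mul, h0, zero_mul, zero_add, map_mul, minpoly.aeval, zero_mul] at hder'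
    exact hder' rfl
  set F := AlgebraicClosure (RatFunc K)
  set T : F := algebraMap (RatFunc K) F RatFunc.X with hT
  have htr : aeval T r ≠ 0 := by
    rw [hT, aeval_algebraMap_apply, RatFunc.aeval_X_left_eq_algebraMap, _root_.map_ne_zero]
    exact RatFunc.algebraMap_ne_zero hr
  have hval : ∀ τ : F, aeval τ μ = 0 → ∀ y ∈ ({f, g} : Set (RatFunc K)),
      RatFunc.IsUnitAt τ y ∧ RatFunc.eval (algebraMap K F) τ y = algebraMap (RatFunc K) F y := by
    intro τ hτ y hy
    have h1 : aeval τ (RatFunc.fiberPoly E ⟨y, hmem y hy⟩) = 0 := by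
      obtain ⟨q, hq⟩ := hdvd ⟨y, hmem y hy⟩
      rw [hq, map_mul, hτ, zero_mul]
    rw [RatFunc.aeval_fiberPoly, sub_eq_zero,
      IsScalarTower.algebraMap_apply E (RatFunc K) F] at h1
    change aeval τ y.num = algebraMap (RatFunc K) F y * aeval τ y.denom at h1
    have h2 : aeval τ y.denom ≠ 0 := by
      intro h2
      obtain ⟨u, v, huv⟩ := y.isCoprime_num_denom
      have h3 := congrArg (aeval τ) huv
      simp [h1, h2] at h3
    refine ⟨⟨?_, h2⟩, ?_⟩
    · rw [h1]
      exact mul_ne_zero ((_root_.map_ne_zero _).2 (hne0 y hy)) h2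
    · rw [RatFunc.eval_eq_aeval_div, h1, mul_div_cancel_right₀ _ h2]
  have hTμ : aeval T μ = 0 := by
    rw [hT, aeval_algebraMap_apply, minpoly.aeval, map_zero]
  have hfm : f ∈ ({f, g} : Set (RatFunc K)) := by simp
  have hgm : g ∈ ({f, g} : Set (RatFunc K)) := by simp
  have huniq : ∀ τ : F, aeval τ μ = 0 → τ = T := by
    intro τ hτ
    by_contra hne
    refine htr (h F T τ (hval T hTμ f hfm).1 (hval T hTμ g hgm).1 (hval τ hτ f hfm).1
      (hval τ hτ g hgm).1 ?_ ?_ (Ne.symm hne))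
    · rw [(hval T hTμ f hfm).2, (hval τ hτ f hfm).2]
    · rw [(hval T hTμ g hgm).2, (hval τ hτ g hgm).2]
  have hcard : Fintype.card (μ.rootSet F) = μ.natDegree :=
    card_rootSet_eq_natDegree hsep (IsAlgClosed.splits _)
  have hle : Fintype.card (μ.rootSet F) ≤ 1 := by
    rw [Fintype.card_le_one_iff]
    intro y z
    rw [Subtype.ext_iff, huniq y (mem_rootSet.1 y.2).2, huniq z (mem_rootSet.1 z.2).2]
  have hdeg : μ.degree = 1 := by
    rw [← Nat.cast_one, degree_eq_iff_natDegree_eq_of_pos one_pos]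
    exact le_antisymm (hcard ▸ hle) (minpoly.natDegree_pos hint)
  obtain ⟨y, hy⟩ := minpoly.mem_range_of_degree_eq_one E _ hdeg
  have hXE : (RatFunc.X : RatFunc K) ∈ E := hy ▸ y.2
  rw [IsTorusBirational, ← hE, eq_top_iff, ← RatFunc.adjoin_X, IntermediateField.adjoin_le_iff,
    Set.singleton_subset_iff]
  exact hXE

end

theorem proposition3p1 {K : Type*} [Field K] [IsAlgClosed K] (R : ℕ) (m n : Fin R → ℤ)
    (α β : K) (hα : α ≠ 0) (hβ : β ≠ 0) (v : Fin R → K) (i j : Fin R) (hij : i ≠ j)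
    (hind : LinearIndependent ℤ ![(m i, n i), (m j, n j)]) :
    GenericPair fun a b : K =>
      let w : Fin R → K := Function.update (Function.update v i a) j b
      let f : RatFunc K := factoredRatFunc α w m
      let g : RatFunc K := factoredRatFunc β w n
      HasTorusDegree f g 1 ∧
        ((ringChar K = 0 ∨
            ¬ ((∃ h : RatFunc K, f = h ^ ringChar K) ∧ (∃ h : RatFunc K, g = h ^ ringChar K))) →
          IsTorusBirational f g) := by
  have : Infinite K := IsAlgClosed.instInfinite
  have hdet : m i * n j - m j * n i ≠ 0 := by
    intro h0
    rw [LinearIndependent.pair_iff] at hind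
    have h1 := hind (n j) (-n i) (by ext <;> simp <;> linarith)
    have h2 := hind (m j) (-m i) (by ext <;> simp <;> linarith)
    have h3 := hind 1 0 (by ext <;> simp <;> omega)
    exact one_ne_zero h3.1
  obtain ⟨H, hH, hgen⟩ := genericPair_separates R m n α β hα hβ v i j hij hdet
  refine ⟨H, hH, fun a b hab ↦ ?_⟩
  obtain ⟨r, hr, hsep⟩ := hgen a b hab
  intro w f g
  refine ⟨hasTorusDegree_one_of_separates hr (hsep K), fun hchar ↦ ?_⟩
  refine isTorusBirational_of_separates (factoredRatFunc_ne_zero hα w m)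
    (factoredRatFunc_ne_zero hβ w n) hr hsep ?_
  by_contra! hder
  obtain ⟨hf₁, hf₂⟩ := RatFunc.derivative_num_denom_eq_zero (hder f (by simp))
  obtain ⟨hg₁, hg₂⟩ := RatFunc.derivative_num_denom_eq_zero (hder g (by simp))
  rcases CharP.char_is_prime_or_zero K (ringChar K) with hp | hp
  · have : Fact (ringChar K).Prime := ⟨hp⟩
    exact hchar.elim hp.ne_zero fun h ↦
      h ⟨RatFunc.exists_eq_pow_of_derivative_eq_zero _ hf₁ hf₂,
        RatFunc.exists_eq_pow_of_derivative_eq_zero _ hg₁ hg₂⟩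
  · have : CharZero K := (CharP.ringChar_zero_iff_CharZero K).1 hp
    obtain ⟨c, hc⟩ := RatFunc.exists_eq_C_of_derivative_eq_zero hf₁ hf₂
    obtain ⟨d, hd⟩ := RatFunc.exists_eq_C_of_derivative_eq_zero hg₁ hg₂
    -- Constant functions do not separate `X` from `X + 1`.
    have hf0 : f ≠ 0 := factoredRatFunc_ne_zero hα w m
    have hg0 : g ≠ 0 := factoredRatFunc_ne_zero hβ w n
    rw [hc] at hf0
    rw [hd] at hg0
    have hunit : ∀ (e : K) (t : RatFunc K), RatFunc.C e ≠ 0 →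
        RatFunc.IsUnitAt t (RatFunc.C e) := by
      intro e t he
      simpa [RatFunc.IsUnitAt] using he
    have := hsep (RatFunc K) RatFunc.X (RatFunc.X + 1)
    change RatFunc.IsUnitAt _ f → RatFunc.IsUnitAt _ g → RatFunc.IsUnitAt _ f →
      RatFunc.IsUnitAt _ g → RatFunc.eval _ _ f = RatFunc.eval _ _ f →
      RatFunc.eval _ _ g = RatFunc.eval _ _ g → _ at this
    rw [hc, hd] at this
    have h0 := this (hunit c _ hf0) (hunit d _ hg0) (hunit c _ hf0) (hunit d _ hg0) (by simp)
      (by simp) (by simp)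
    rw [RatFunc.aeval_X_left_eq_algebraMap] at h0
    exact RatFunc.algebraMap_ne_zero hr h0
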